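/- Let $K$ be a field and $X$ a finite nonempty connected poset (any two elements are joined by a walk, i.e. a sequence $u_0,\dots,u_m$ in which, for each $i$, one of $u_i,u_{i+1}$ covers the other). Let $I(X,K)$ be the incidence algebra, with standard basis $e_{xy}$ ($x\le y$), $e_x:=e_{xx}$, $[f,g]=fg-gf$, $D(X,K)=\langle e_x: x\in X\rangle$, $\mathcal B=\{e_{xy}:x<y\}$ and $X^2_<=\{(x,y):x<y\}$. A linear map $\varphi:I(X,K)\to I(X,K)$ is a strong commutativity preserver if $[f,g]=0\iff[\varphi(f),\varphi(g)]=0$ for all $f,g$; it preserves the diagonality if $\varphi(D(X,K))\subseteq D(X,K)$. Shift type. For a linear map $\alpha:I(X,K)\to D(X,K)$ put $S_\alpha(f)=f+\alpha(f)$. The map $S_\alpha$ is of shift type if it is a strong commutativity preserver and (i) $[\alpha(e_{xy}),e_{uv}]=0$ for all $e_{xy}\neq e_{uv}$ in $\mathcal B$; (ii) $[\alpha(e_z),e_{xy}]=0$ for all $z\in X$ and $e_{xy}\in\mathcal B$ such that $z\notin\{x,y\}$ or $y$ does not cover $x$; (iii) $[\alpha(e_x),e_{xy}]=[e_{xy},\alpha(e_y)]$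 and (iv) $[\alpha(e_x),e_{xy}]\neq-e_{xy}$ whenever $y$ covers $x$. Pure preservers. A bijective strong commutativity preserver $\tau$ preserving the diagonality is pure if there are a bijection $\theta:\mathcal B\to\mathcal B$ and $\sigma:X^2_<\to K^*$ with $\tau(e_{xy})=\sigma(x,y)\theta(e_{xy})$ for all $x<y$; then $\tau$ is said to induce $(\theta,\sigma)$. Quadruples. Fix $x_1\in X$. Consider $(\theta,\sigma,c,\kappa)$ with a bijection $\theta:\mathcal B\to\mathcal B$, maps $\sigma,c:X^2_<\to K^*$ and a family $\kappa=(k_z)_{z\in X}$ in $K$ such that: (a) $\theta$ is monotone on maximal chains: for each maximal chain $u_1<\dots<u_m$ there is a maximal chain $v_1<\dots<v_m$ such that either $\theta(e_{u_iu_j})=e_{v_iv_j}$ for all $i<j$, or $\theta(e_{u_iu_j})=e_{v_{m-j+1}v_{m-i+1}}$ for all $i<j$; (b) $\sigma$ is $c$-compatible with $\theta$: for all $x<y<z$, $c(x,z)\sigma(x,z)=\sigma(x,y)\sigma(y,z)$ if $\theta(e_{xz})=\theta(e_{xy})\theta(e_{yz})$, and $c(x,z)\sigma(x,z)=-\sigma(x,y)\sigma(y,z)$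 if $\theta(e_{xz})=\theta(e_{yz})\theta(e_{xy})$; (c) $c$ is constant on maximal chains: $c(x,y)=c(x',y')$ whenever $x<y$ and $x'<y'$ all lie in one maximal chain; (d) $(\theta,c)$ is admissible: $s^+_\Gamma(z)-s^-_\Gamma(z)=t^+_\Gamma(z)-t^-_\Gamma(z)$ for all closed walks $\Gamma$ and all $z\in X$. Here, for any walk $\Gamma:u_0,\dots,u_m$, $s^+_\Gamma(z)$ is the sum of $c(z,w_i)$ over those $i<m$ with $u_i<u_{i+1}$ for which there is $w_i>z$ with $\theta(e_{zw_i})=e_{u_iu_{i+1}}$, and $t^+_\Gamma(z)$ is the sum of $c(w_i,z)$ over those $i<m$ with $u_i<u_{i+1}$ for which there is $w_i<z$ with $\theta(e_{w_iz})=e_{u_iu_{i+1}}$; $s^-_\Gamma(z)$ and $t^-_\Gamma(z)$ are the same sums over $i$ with $u_i>u_{i+1}$, with $e_{u_{i+1}u_i}$ in place of $e_{u_iu_{i+1}}$; (e) $\sum_{z\in X}k_z\neq0$. Then $\tau_{\theta,\sigma,c,\kappa}$ is the linear map given by $\tau(e_{xy})=\sigma(x,y)\theta(e_{xy})$ for $x<y$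 and $$\tau(e_z)=\sum_{v\in X}\bigl(k_z-s^+_{\Gamma_v}(z)+s^-_{\Gamma_v}(z)+t^+_{\Gamma_v}(z)-t^-_{\Gamma_v}(z)\bigr)e_v,\qquad z\in X,$$ where $\Gamma_v$ is any walk from $x_1$ to $v$ (by (d) the choice is irrelevant). Theorem. For every bijective strong commutativity preserver $\varphi:I(X,K)\to I(X,K)$ which preserves the diagonality there are a linear map $\alpha:I(X,K)\to D(X,K)$ with $S_\alpha$ of shift type and a quadruple $(\theta,\sigma,c,\kappa)$ satisfying (a)–(e) such that $$\varphi=S_\alpha\circ\tau_{\theta,\sigma,c,\kappa}.$$ Moreover $\tau=\tau_{\theta,\sigma,c,\kappa}$ is a pure commutativity preserver inducing $(\theta,\sigma)$, with $\tau(e_z)(x_1,x_1)=k_z$ for all $z\in X$ and $\tau(e_x)(u,u)-\tau(e_x)(v,v)=c(x,y)$ whenever $x<y$ and $\theta(e_{xy})=e_{uv}$. -/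

import Mathlib

namespace CommPres

/-- Pairs `(x, y)` with `x < y`. The basis `𝓑 = {e_{xy} : x < y}` of the Jacobson radical is indexed
by these pairs, so a bijection `𝓑 → 𝓑` is written as a permutation of `LtPair X`. -/
abbrev LtPair (X : Type*) [PartialOrder X] : Type _ := {p : X × X // p.1 < p.2}

section Algebra

variable (K : Type*) {X : Type*} [Field K] [PartialOrder X] [DecidableEq X]

/-- The standard basis element `e_{xy}`, for `x ≤ y`. -/
def stdBasis (x y : X) (hxy : x ≤ y) : IncidenceAlgebra K X where
  toFun u v := if u = x ∧ v = y then 1 else 0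
  eq_zero_of_not_le' u v huv := by
    rw [if_neg]
    rintro ⟨rfl, rfl⟩
    exact huv hxy

/-- `e_x = e_{xx}`. -/
def eDiag (x : X) : IncidenceAlgebra K X := stdBasis K x x le_rfl

/-- `e_{xy}` for `x < y`. -/
def eLt (p : LtPair X) : IncidenceAlgebra K X := stdBasis K p.1.1 p.1.2 p.2.le

variable (X) in
/-- `D(X,K)`: the elements vanishing off the diagonal. -/
def diagonal : Submodule K (IncidenceAlgebra K X) where
  carrier := {f | ∀ x y, x ≠ y → f x y = 0}
  add_mem' := by
    intro f g hf hg x y hxy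
    simp [hf x y hxy, hg x y hxy]
  zero_mem' := by
    intro x y _
    simp
  smul_mem' := by
    intro k f hf x y hxy
    simp [hf x y hxy]

end Algebra

section Preservers

variable {K X : Type*} [Field K] [PartialOrder X] [DecidableEq X] [LocallyFiniteOrder X]

/-- A strong commutativity preserver: `[f, g] = 0 ↔ [φ f, φ g] = 0`. -/
def IsStrongCommPreserver (φ : IncidenceAlgebra K X →ₗ[K] IncidenceAlgebra K X) : Prop :=
  ∀ f g : IncidenceAlgebra K X, ⁅f, g⁆ = 0 ↔ ⁅φ f, φ g⁆ = 0

/-- `φ(D(X,K)) ⊆ D(X,K)`. -/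
def PreservesDiagonal (φ : IncidenceAlgebra K X →ₗ[K] IncidenceAlgebra K X) : Prop :=
  ∀ f ∈ diagonal K X, φ f ∈ diagonal K X

/-- The linear map `S_α(f) = f + α(f)`, for a linear `α : I(X,K) → D(X,K)`. -/
def shiftMap (α : IncidenceAlgebra K X →ₗ[K] diagonal K X) :
    IncidenceAlgebra K X →ₗ[K] IncidenceAlgebra K X :=
  LinearMap.id + (diagonal K X).subtype ∘ₗ α

/-- `S_α` is a commutativity preserver of shift type: it is a strong commutativity preserver and `α`
satisfies the four conditions below. For `x < y`, the interval from `x` to `y` has length `1`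
exactly when `x ⋖ y`, and length `> 1` otherwise. -/
structure IsShiftType (α : IncidenceAlgebra K X →ₗ[K] diagonal K X) : Prop where
  strong : IsStrongCommPreserver (shiftMap α)
  lt_lt : ∀ p q : LtPair X, p ≠ q →
    ⁅(α (eLt K p) : IncidenceAlgebra K X), eLt K q⁆ = 0
  diag_lt : ∀ (z : X) (p : LtPair X), ((z ≠ p.1.1 ∧ z ≠ p.1.2) ∨ ¬ p.1.1 ⋖ p.1.2) →
    ⁅(α (eDiag K z) : IncidenceAlgebra K X), eLt K p⁆ = 0
  cover : ∀ p : LtPair X, p.1.1 ⋖ p.1.2 →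
    ⁅(α (eDiag K p.1.1) : IncidenceAlgebra K X), eLt K p⁆ =
      ⁅eLt K p, (α (eDiag K p.1.2) : IncidenceAlgebra K X)⁆
  cover_ne : ∀ p : LtPair X, p.1.1 ⋖ p.1.2 →
    ⁅(α (eDiag K p.1.1) : IncidenceAlgebra K X), eLt K p⁆ ≠ -eLt K p

/-- `φ` induces `(θ, σ)`: `φ(e_{xy}) = σ(x,y) θ(e_{xy})` for all `x < y`. -/
def Induces (φ : IncidenceAlgebra K X →ₗ[K] IncidenceAlgebra K X)
    (θ : Equiv.Perm (LtPair X)) (σ : LtPair X → Kˣ) : Prop :=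
  ∀ p : LtPair X, φ (eLt K p) = (σ p : K) • eLt K (θ p)

/-- A pure commutativity preserver: a bijective strong commutativity preserver which preserves the
diagonality and induces some pair `(θ, σ)`. -/
structure IsPure (φ : IncidenceAlgebra K X →ₗ[K] IncidenceAlgebra K X) : Prop where
  bijective : Function.Bijective φ
  strong : IsStrongCommPreserver φ
  diag : PreservesDiagonal φ
  induces : ∃ (θ : Equiv.Perm (LtPair X)) (σ : LtPair X → Kˣ), Induces φ θ σ

/-- `σ` is `c`-compatible with `θ`, for this particular `c`. -/
def IsCompatible (θ : Equiv.Perm (LtPair X)) (σ c : LtPair X → Kˣ) : Prop :=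
  ∀ (x y z : X) (hxy : x < y) (hyz : y < z),
    (eLt K (θ ⟨(x, z), hxy.trans hyz⟩) =
        eLt K (θ ⟨(x, y), hxy⟩) * eLt K (θ ⟨(y, z), hyz⟩) →
      (c ⟨(x, z), hxy.trans hyz⟩ : K) * σ ⟨(x, z), hxy.trans hyz⟩ =
        σ ⟨(x, y), hxy⟩ * σ ⟨(y, z), hyz⟩) ∧
    (eLt K (θ ⟨(x, z), hxy.trans hyz⟩) =
        eLt K (θ ⟨(y, z), hyz⟩) * eLt K (θ ⟨(x, y), hxy⟩) →
      (c ⟨(x, z), hxy.trans hyz⟩ : K) * σ ⟨(x, z), hxy.trans hyz⟩ =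
        -(σ ⟨(x, y), hxy⟩ * σ ⟨(y, z), hyz⟩))

end Preservers

section Chains

variable {X : Type*} [PartialOrder X]

/-- `u 0 < u 1 < … < u (m - 1)` is a maximal chain in `X`. -/
structure IsMaximalChain {m : ℕ} (u : Fin m → X) : Prop where
  strictMono : StrictMono u
  isMaxChain : IsMaxChain (· ≤ ·) (Set.range u)

/-- `θ(e_{u_i u_j}) = e_{v_i v_j}` for some maximal chain `v` and all `i < j`. -/
def IsIncreasingOn (θ : Equiv.Perm (LtPair X)) {m : ℕ} (u : Fin m → X) (hu : StrictMono u) : Prop :=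
  ∃ v : Fin m → X, IsMaximalChain v ∧
    ∀ (i j : Fin m) (hij : i < j), (θ ⟨(u i, u j), hu hij⟩).1 = (v i, v j)

/-- `θ(e_{u_i u_j}) = e_{v_{j'} v_{i'}}` for some maximal chain `v` and all `i < j`, where
`i ↦ i'` reverses the order of the indices. -/
def IsDecreasingOn (θ : Equiv.Perm (LtPair X)) {m : ℕ} (u : Fin m → X) (hu : StrictMono u) : Prop :=
  ∃ v : Fin m → X, IsMaximalChain v ∧
    ∀ (i j : Fin m) (hij : i < j), (θ ⟨(u i, u j), hu hij⟩).1 = (v j.rev, v i.rev)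

/-- `θ` is monotone on maximal chains in `X`. -/
def IsMonotoneOnMaximalChains (θ : Equiv.Perm (LtPair X)) : Prop :=
  ∀ (m : ℕ) (u : Fin m → X) (hu : IsMaximalChain u),
    IsIncreasingOn θ u hu.strictMono ∨ IsDecreasingOn θ u hu.strictMono

/-- `c` takes a single value on the pairs of elements of each maximal chain in `X`. -/
def IsConstantOnMaximalChains {K : Type*} [Field K] (c : LtPair X → Kˣ) : Prop :=
  ∀ (m : ℕ) (u : Fin m → X) (hu : IsMaximalChain u) (i j k l : Fin m) (hij : i < j) (hkl : k < l),
    c ⟨(u i, u j), hu.strictMono hij⟩ = c ⟨(u k, u l), hu.strictMono hkl⟩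

end Chains

section Walks

variable {K X : Type*} [Field K] [PartialOrder X]

/-!  A walk in `X` (consecutive elements in a covering relation, in either direction) is a walk in
the Hasse diagram of `X`. Its steps `(u_i, u_{i+1})` are the darts of the walk. -/

open Classical in
/-- `s⁺(z) = ∑ c(z, w_i)` over the steps with `u_i < u_{i+1}` and `θ(e_{z w_i}) = e_{u_i u_{i+1}}`
for some `w_i > z`. -/
noncomputable def sPlus (θ : Equiv.Perm (LtPair X)) (c : LtPair X → Kˣ) {u v : X}
    (Γ : (SimpleGraph.hasse X).Walk u v) (z : X) : K :=
  (Γ.darts.map fun d => if h : d.fst < d.snd then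
    (if (θ.symm ⟨(d.fst, d.snd), h⟩).1.1 = z then (c (θ.symm ⟨(d.fst, d.snd), h⟩) : K) else 0)
    else 0).sum

open Classical in
/-- `s⁻(z) = ∑ c(z, w_i)` over the steps with `u_i > u_{i+1}` and `θ(e_{z w_i}) = e_{u_{i+1} u_i}`
for some `w_i > z`. -/
noncomputable def sMinus (θ : Equiv.Perm (LtPair X)) (c : LtPair X → Kˣ) {u v : X}
    (Γ : (SimpleGraph.hasse X).Walk u v) (z : X) : K :=
  (Γ.darts.map fun d => if h : d.snd < d.fst then
    (if (θ.symm ⟨(d.snd, d.fst), h⟩).1.1 = z then (c (θ.symm ⟨(d.snd, d.fst), h⟩) : K) else 0)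
    else 0).sum

open Classical in
/-- `t⁺(z) = ∑ c(w_i, z)` over the steps with `u_i < u_{i+1}` and `θ(e_{w_i z}) = e_{u_i u_{i+1}}`
for some `w_i < z`. -/
noncomputable def tPlus (θ : Equiv.Perm (LtPair X)) (c : LtPair X → Kˣ) {u v : X}
    (Γ : (SimpleGraph.hasse X).Walk u v) (z : X) : K :=
  (Γ.darts.map fun d => if h : d.fst < d.snd then
    (if (θ.symm ⟨(d.fst, d.snd), h⟩).1.2 = z then (c (θ.symm ⟨(d.fst, d.snd), h⟩) : K) else 0)
    else 0).sum

open Classical in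
/-- `t⁻(z) = ∑ c(w_i, z)` over the steps with `u_i > u_{i+1}` and `θ(e_{w_i z}) = e_{u_{i+1} u_i}`
for some `w_i < z`. -/
noncomputable def tMinus (θ : Equiv.Perm (LtPair X)) (c : LtPair X → Kˣ) {u v : X}
    (Γ : (SimpleGraph.hasse X).Walk u v) (z : X) : K :=
  (Γ.darts.map fun d => if h : d.snd < d.fst then
    (if (θ.symm ⟨(d.snd, d.fst), h⟩).1.2 = z then (c (θ.symm ⟨(d.snd, d.fst), h⟩) : K) else 0)
    else 0).sum

/-- The pair `(θ, c)` is admissible: `s⁺ - s⁻ = t⁺ - t⁻` for every closed walk. -/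
def IsAdmissible (θ : Equiv.Perm (LtPair X)) (c : LtPair X → Kˣ) : Prop :=
  ∀ (u : X) (Γ : (SimpleGraph.hasse X).Walk u u) (z : X),
    sPlus θ c Γ z - sMinus θ c Γ z = tPlus θ c Γ z - tMinus θ c Γ z

/-- The total increment `∑ᵢ Δ_{Γ,i}(z)` of the diagonal entries along the walk `Γ`. With
`θ(e_{vw}) = e_{ab}`, where `a < b` are the two ends of the `i`-th step, the summand is
`-c(v,w)` for an ascending step with `z = v` or a descending one with `z = w`, it is
`c(v,w)` for an ascending step with `z = w` or a descending one with `z = v`, and `0` otherwise. -/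
noncomputable def walkIncrement (θ : Equiv.Perm (LtPair X)) (c : LtPair X → Kˣ) {u v : X}
    (Γ : (SimpleGraph.hasse X).Walk u v) (z : X) : K :=
  -sPlus θ c Γ z + sMinus θ c Γ z + tPlus θ c Γ z - tMinus θ c Γ z

/-- The scalars `c_φ(x,y) = φ(e_x)(u,u) - φ(e_x)(v,v)`, where `θ(e_{xy}) = e_{uv}`. -/
def attachedScalar [DecidableEq X] (φ : IncidenceAlgebra K X →ₗ[K] IncidenceAlgebra K X)
    (θ : Equiv.Perm (LtPair X)) (p : LtPair X) : K :=
  φ (eDiag K p.1.1) (θ p).1.1 (θ p).1.1 - φ (eDiag K p.1.1) (θ p).1.2 (θ p).1.2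

end Walks

section Tau

variable {K X : Type*} [Field K] [PartialOrder X] [Fintype X] [DecidableEq X]

open Classical in
/-- The linear map `τ = τ_{θ,σ,c,κ}`, with respect to a base point `x₁`:
`τ(e_{xy}) = σ(x,y) θ(e_{xy})` for `x < y`, and `τ(e_z)` is the diagonal element whose value at
`(v, v)` is `κ_z` plus the increment along a walk from `x₁` to `v`; so `τ(e_z)(x₁,x₁) = κ_z`
whenever `(θ, c)` is admissible, in which case the choice of the walks is irrelevant. -/
noncomputable def tau (hconn : (SimpleGraph.hasse X).Connected) (x₁ : X)
    (θ : Equiv.Perm (LtPair X)) (σ c : LtPair X → Kˣ) (κ : X → K) :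
    IncidenceAlgebra K X →ₗ[K] IncidenceAlgebra K X where
  toFun f :=
    ∑ z : X, f z z •
        ∑ v : X, (κ z + walkIncrement θ c (hconn.preconnected x₁ v).some z) • eDiag K v +
      ∑ p : LtPair X, (f p.1.1 p.1.2 * σ p) • eLt K (θ p)
  map_add' f g := by
    simp only [IncidenceAlgebra.add_apply, add_smul, add_mul, Finset.sum_add_distrib]
    abel
  map_smul' k f := by
    simp only [IncidenceAlgebra.constSMul_apply, smul_eq_mul, mul_smul, mul_assoc, smul_add,
      Finset.smul_sum, RingHom.id_apply]

end Tau

end CommPres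

/-! A commutativity preserver is controlled by which basis elements commute with which diagonal
elements. Write `Φ` for the action of `φ` on diagonals and `δ_p(d) = d(x) - d(y)` for `p = (x, y)`.
Since `e_p` commutes with `d` exactly when `δ_p(d) = 0`, every pair `q` in the off-diagonal support
of `φ(e_p)` has `δ_q ∘ Φ` proportional to `δ_p`. Distinct pairs have non-proportional differences
and `Φ` is bijective, so the support is one pair `θ(p)`. Hence `φ(e_p) = A(p) + σ(p) e_{θ(p)}` with
`A(p)` diagonal, and `δ_{θ(p)} ∘ Φ = c(p) δ_p` (`exists_isMonomial`).

Under this transport the relation `δ_{xz} = δ_{xy} + δ_{yz}` makes `c` constant on the triple and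
makes `θ` preserve or reverse it (`IsMonomial.triple`); the same argument applies to `θ⁻¹`, and
triples assemble into maximal chains. Brackets give compatibility of `σ` (through
`IsMonomial.lie_pair`) and show that `A(p)` has equal entries at the ends of `θ(q)` for `q ≠ p`
(`IsMonomial.diff_eq_zero`).

The shift `α` absorbs the `A(p)`. By the last property `S_α` preserves all brackets exactly
(`shiftMap_lie`), so what remains is still a strong preserver. It is `τ`, because the increments
defining `τ(e_z)` telescope to differences of entries of `Φ(e_z)` (`walkIncrement_eq`); on closed
walks this is admissibility. -/

namespace CommPres

/-! ### Coordinates at strict pairs -/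

section Evaluation

variable {K X : Type*} [Field K] [PartialOrder X]

/-- Evaluation of an element of the incidence algebra at a pair. -/
def evalPair (p : LtPair X) : IncidenceAlgebra K X →ₗ[K] K where
  toFun f := f p.1.1 p.1.2
  map_add' _ _ := rfl
  map_smul' _ _ := rfl

lemma evalPair_apply (p : LtPair X) (f : IncidenceAlgebra K X) :
    evalPair p f = f p.1.1 p.1.2 := rfl

lemma ext_pair {f g : IncidenceAlgebra K X} (h₁ : ∀ x, f x x = g x x)
    (h₂ : ∀ p, evalPair p f = evalPair p g) : f = g := by
  ext x y hxy
  rcases hxy.eq_or_lt with rfl | h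
  · exact h₁ x
  · exact h₂ ⟨(x, y), h⟩

end Evaluation

/-! ### Diagonal elements and the standard basis -/

section DiagonalElements

variable {K X : Type*} [Field K] [PartialOrder X] [DecidableEq X]

/-- The diagonal element with prescribed diagonal entries. -/
def diagElem : (X → K) →ₗ[K] IncidenceAlgebra K X where
  toFun d := ⟨fun u v => if u = v then d u else 0, fun u v huv => if_neg fun h => huv h.le⟩
  map_add' d d' := by
    ext u v
    simp only [IncidenceAlgebra.add_apply, IncidenceAlgebra.coe_mk, Pi.add_apply]
    split_ifs <;> simp
  map_smul' k d := by
    ext u v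
    simp [IncidenceAlgebra.constSMul_apply]

lemma diagElem_apply (d : X → K) (u v : X) : diagElem d u v = if u = v then d u else 0 := rfl

lemma diagElem_apply_self (d : X → K) (u : X) : diagElem d u u = d u := if_pos rfl

lemma diagElem_apply_pair (d : X → K) (p : LtPair X) : diagElem d p.1.1 p.1.2 = 0 :=
  if_neg p.2.ne

lemma diagElem_mem (d : X → K) : diagElem d ∈ diagonal K X := fun _ _ h => if_neg h

lemma eq_diagElem_of_mem {f : IncidenceAlgebra K X} (hf : f ∈ diagonal K X) :
    f = diagElem fun x => f x x := by
  ext u v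
  rw [diagElem_apply]
  split_ifs with h
  · rw [h]
  · exact hf u v h

lemma stdBasis_apply (x y : X) (h : x ≤ y) (u v : X) :
    stdBasis K x y h u v = if u = x ∧ v = y then 1 else 0 := rfl

lemma eLt_apply (p : LtPair X) (u v : X) :
    eLt K p u v = if u = p.1.1 ∧ v = p.1.2 then 1 else 0 := rfl

lemma eLt_apply_self_self (p : LtPair X) (u : X) : eLt K p u u = 0 := by
  rw [eLt_apply, if_neg]
  rintro ⟨h, h'⟩
  exact p.2.ne (h.symm.trans h')

lemma eLt_apply_pair (p q : LtPair X) : eLt K p q.1.1 q.1.2 = if q = p then 1 else 0 := by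
  rw [eLt_apply]
  congr 1
  simp [Subtype.ext_iff, Prod.ext_iff]

lemma eLt_ne_zero (p : LtPair X) : eLt K p ≠ 0 := fun h => by
  have := congrArg (fun f : IncidenceAlgebra K X => f p.1.1 p.1.2) h
  simp [eLt_apply_pair] at this

lemma eLt_injective : Function.Injective (eLt K : LtPair X → IncidenceAlgebra K X) := by
  intro p q h
  have := congrArg (fun f : IncidenceAlgebra K X => f p.1.1 p.1.2) h
  simpa [eLt_apply_pair] using this

lemma eDiag_eq_diagElem (z : X) : eDiag K z = diagElem (Pi.single z 1) := by
  ext u v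
  rw [diagElem_apply, eDiag, stdBasis_apply, Pi.single_apply]
  split_ifs <;> grind

lemma diagElem_eq_sum [Fintype X] (d : X → K) : diagElem d = ∑ z, d z • eDiag K z := by
  simp_rw [eDiag_eq_diagElem, ← map_smul, ← map_sum]
  congr 1
  ext x
  simp [Finset.sum_apply, Pi.single_apply]

@[simp] lemma evalPair_diagElem (p : LtPair X) (d : X → K) : evalPair p (diagElem d) = 0 :=
  diagElem_apply_pair d p

@[simp] lemma evalPair_eLt (p q : LtPair X) :
    evalPair p (eLt K q) = if p = q then 1 else 0 := eLt_apply_pair q p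

open Classical in
lemma eq_diagElem_add_sum [Fintype X] (f : IncidenceAlgebra K X) :
    f = diagElem (fun x => f x x) + ∑ p : LtPair X, evalPair p f • eLt K p := by
  apply ext_pair
  · intro x
    have : (∑ p : LtPair X, evalPair p f • eLt K p) ∈
        LinearMap.ker (LinearMap.mk ⟨fun g : IncidenceAlgebra K X => g x x, fun _ _ => rfl⟩
          (fun _ _ => rfl) : IncidenceAlgebra K X →ₗ[K] K) :=
      Submodule.sum_mem _ fun p _ => Submodule.smul_mem _ _ (eLt_apply_self_self p x)
    rw [IncidenceAlgebra.add_apply, diagElem_apply_self,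
      show (∑ p : LtPair X, evalPair p f • eLt K p : IncidenceAlgebra K X) x x = 0 from this,
      add_zero]
  · intro q
    simp [map_sum]

lemma linearMap_ext [Fintype X] {M : Type*} [AddCommMonoid M] [Module K M]
    {φ ψ : IncidenceAlgebra K X →ₗ[K] M}
    (h₁ : ∀ z, φ (eDiag K z) = ψ (eDiag K z)) (h₂ : ∀ p, φ (eLt K p) = ψ (eLt K p)) : φ = ψ := by
  classical
  ext f
  rw [eq_diagElem_add_sum f, diagElem_eq_sum]
  simp [map_sum, h₁, h₂]

/-- Finite dimension is what turns injectivity of `τ` into bijectivity. -/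
instance [Fintype X] : Module.Finite K (IncidenceAlgebra K X) := by
  let ι : IncidenceAlgebra K X →ₗ[K] (X → X → K) :=
    { toFun f := f, map_add' _ _ := rfl, map_smul' _ _ := rfl }
  exact Module.Finite.of_injective ι DFunLike.coe_injective

end DiagonalElements

/-! ### Brackets of basis elements -/

section Brackets

variable {K X : Type*} [Field K] [PartialOrder X] [DecidableEq X] [LocallyFiniteOrder X]

attribute [local instance] LieRing.ofAssociativeRing

lemma diagElem_mul_apply (d : X → K) (g : IncidenceAlgebra K X) (u v : X) :
    (diagElem d * g) u v = d u * g u v := by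
  rw [IncidenceAlgebra.mul_apply]
  by_cases h : u ≤ v
  · rw [Finset.sum_eq_single u]
    · rw [diagElem_apply_self]
    · intro b _ hb
      rw [diagElem_apply, if_neg hb.symm, zero_mul]
    · exact fun hu => absurd (Finset.left_mem_Icc.2 h) hu
  · rw [Finset.Icc_eq_empty h, Finset.sum_empty, IncidenceAlgebra.apply_eq_zero_of_not_le h,
      mul_zero]

lemma mul_diagElem_apply (d : X → K) (g : IncidenceAlgebra K X) (u v : X) :
    (g * diagElem d) u v = g u v * d v := by
  rw [IncidenceAlgebra.mul_apply]
  by_cases h : u ≤ v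
  · rw [Finset.sum_eq_single v]
    · rw [diagElem_apply_self]
    · intro b _ hb
      rw [diagElem_apply, if_neg hb, mul_zero]
    · exact fun hu => absurd (Finset.right_mem_Icc.2 h) hu
  · rw [Finset.Icc_eq_empty h, Finset.sum_empty, IncidenceAlgebra.apply_eq_zero_of_not_le h,
      zero_mul]

lemma diagElem_lie_apply (d : X → K) (g : IncidenceAlgebra K X) (u v : X) :
    ⁅diagElem d, g⁆ u v = (d u - d v) * g u v := by
  rw [Ring.lie_def, IncidenceAlgebra.sub_apply, diagElem_mul_apply, mul_diagElem_apply]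
  ring

lemma diagElem_lie_eq_zero_iff (d : X → K) (g : IncidenceAlgebra K X) :
    ⁅diagElem d, g⁆ = 0 ↔ ∀ p : LtPair X, evalPair p g ≠ 0 → d p.1.1 = d p.1.2 := by
  constructor
  · intro h p hp
    have := congrArg (fun f : IncidenceAlgebra K X => f p.1.1 p.1.2) h
    simp only [diagElem_lie_apply, IncidenceAlgebra.zero_apply] at this
    exact sub_eq_zero.1 ((mul_eq_zero.1 this).resolve_right hp)
  · intro h
    apply ext_pair
    · intro x
      rw [diagElem_lie_apply, sub_self, zero_mul, IncidenceAlgebra.zero_apply]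
    · intro p
      rw [evalPair_apply, diagElem_lie_apply, map_zero]
      by_cases hp : evalPair p g = 0
      · rw [← evalPair_apply, hp, mul_zero]
      · rw [h p hp, sub_self, zero_mul]

lemma diagElem_lie_eLt (d : X → K) (p : LtPair X) :
    ⁅diagElem d, eLt K p⁆ = (d p.1.1 - d p.1.2) • eLt K p := by
  ext u v
  rw [diagElem_lie_apply, IncidenceAlgebra.constSMul_apply, eLt_apply, smul_eq_mul]
  split_ifs with h
  · rw [h.1, h.2]
  · simp

lemma eLt_lie_diagElem (d : X → K) (p : LtPair X) :
    ⁅eLt K p, diagElem d⁆ = -((d p.1.1 - d p.1.2) • eLt K p) := by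
  rw [← lie_skew, diagElem_lie_eLt]

lemma diagElem_lie_diagElem (d d' : X → K) : ⁅diagElem d, diagElem d'⁆ = 0 := by
  rw [diagElem_lie_eq_zero_iff]
  intro p hp
  simp at hp

lemma eLt_mul_apply (p : LtPair X) (g : IncidenceAlgebra K X) (u v : X) :
    (eLt K p * g) u v = if u = p.1.1 then g p.1.2 v else 0 := by
  rw [IncidenceAlgebra.mul_apply]
  split_ifs with h
  · subst h
    by_cases h : p.1.2 ≤ v
    · rw [Finset.sum_eq_single p.1.2]
      · simp [eLt_apply]
      · intro b _ hb
        simp [eLt_apply, hb]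
      · exact fun hu => absurd (Finset.mem_Icc.2 ⟨p.2.le, h⟩) hu
    · rw [IncidenceAlgebra.apply_eq_zero_of_not_le h]
      refine Finset.sum_eq_zero fun b hb => ?_
      rw [eLt_apply, if_neg, zero_mul]
      rintro ⟨-, rfl⟩
      exact h (Finset.mem_Icc.1 hb).2
  · exact Finset.sum_eq_zero fun b _ => by simp [eLt_apply, h]

lemma eLt_mul_eLt_of_eq {p q r : LtPair X} (h : p.1.2 = q.1.1) (hr : r.1 = (p.1.1, q.1.2)) :
    eLt K p * eLt K q = eLt K r := by
  ext u v
  rw [eLt_mul_apply, eLt_apply, eLt_apply, hr]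
  split_ifs <;> grind

lemma eLt_mul_eLt_of_ne {p q : LtPair X} (h : p.1.2 ≠ q.1.1) : eLt K p * eLt K q = 0 := by
  ext u v
  rw [eLt_mul_apply, eLt_apply]
  simp [h]

lemma eLt_lie_eLt_of_eq {p q r : LtPair X} (h : p.1.2 = q.1.1) (hr : r.1 = (p.1.1, q.1.2)) :
    ⁅eLt K p, eLt K q⁆ = eLt K r := by
  have h' : q.1.2 ≠ p.1.1 := (p.2.trans (h ▸ q.2)).ne'
  rw [Ring.lie_def, eLt_mul_eLt_of_eq h hr, eLt_mul_eLt_of_ne h', sub_zero]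

/-- Two pairs are composable if one of them starts where the other one ends. -/
def Composable {X : Type*} [PartialOrder X] (p q : LtPair X) : Prop :=
  p.1.2 = q.1.1 ∨ q.1.2 = p.1.1

lemma eLt_lie_eLt_eq_zero {p q : LtPair X} (h : ¬ Composable p q) : ⁅eLt K p, eLt K q⁆ = 0 := by
  rw [Composable, not_or] at h
  rw [Ring.lie_def, eLt_mul_eLt_of_ne h.1, eLt_mul_eLt_of_ne h.2, sub_zero]

/-- Composing with a strict pair moves an endpoint of `p`. This allows coefficients at `p` and `q`
to be compared without the bracket term interfering. -/
lemma evalPair_lie_of_left (p q : LtPair X) : evalPair p ⁅eLt K p, eLt K q⁆ = 0 := by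
  rw [Ring.lie_def, map_sub, evalPair_apply, evalPair_apply, eLt_mul_apply, eLt_mul_apply,
    eLt_apply, eLt_apply]
  have := p.2
  have := q.2
  grind

lemma evalPair_lie_of_right (p q : LtPair X) : evalPair q ⁅eLt K p, eLt K q⁆ = 0 := by
  rw [← lie_skew, map_neg, evalPair_lie_of_left, neg_zero]

lemma eLt_lie_eLt_ne_zero {p q : LtPair X} (h : Composable p q) : ⁅eLt K p, eLt K q⁆ ≠ 0 := by
  rcases h with h | h
  · rw [eLt_lie_eLt_of_eq h (r := ⟨(p.1.1, q.1.2), p.2.trans (h ▸ q.2)⟩) rfl]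
    exact eLt_ne_zero _
  · rw [← lie_skew, eLt_lie_eLt_of_eq h (r := ⟨(q.1.1, p.1.2), q.2.trans (h ▸ p.2)⟩) rfl]
    exact neg_ne_zero.2 (eLt_ne_zero _)

end Brackets

/-! ### From triples to maximal chains -/

section Chains

variable {X : Type*} [PartialOrder X]

/-- `θ(e_{xy}) θ(e_{yz}) = θ(e_{xz})`. -/
def IsIncTriple (θ : Equiv.Perm (LtPair X)) {x y z : X} (hxy : x < y) (hyz : y < z) : Prop :=
  (θ ⟨(x, y), hxy⟩).1.2 = (θ ⟨(y, z), hyz⟩).1.1 ∧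
    (θ ⟨(x, z), hxy.trans hyz⟩).1 = ((θ ⟨(x, y), hxy⟩).1.1, (θ ⟨(y, z), hyz⟩).1.2)

/-- `θ(e_{yz}) θ(e_{xy}) = θ(e_{xz})`. -/
def IsDecTriple (θ : Equiv.Perm (LtPair X)) {x y z : X} (hxy : x < y) (hyz : y < z) : Prop :=
  (θ ⟨(y, z), hyz⟩).1.2 = (θ ⟨(x, y), hxy⟩).1.1 ∧
    (θ ⟨(x, z), hxy.trans hyz⟩).1 = ((θ ⟨(y, z), hyz⟩).1.1, (θ ⟨(x, y), hxy⟩).1.2)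

/-- `θ` is monotone on all chains of three elements. -/
def IsMonotoneOnTriples (θ : Equiv.Perm (LtPair X)) : Prop :=
  ∀ ⦃x y z : X⦄ (hxy : x < y) (hyz : y < z), IsIncTriple θ hxy hyz ∨ IsDecTriple θ hxy hyz

lemma IsIncTriple.not_isDecTriple {θ : Equiv.Perm (LtPair X)} {x y z : X} {hxy : x < y}
    {hyz : y < z} (h : IsIncTriple θ hxy hyz) : ¬ IsDecTriple θ hxy hyz := fun h' => by
  have h₁ := (θ ⟨(x, y), hxy⟩).2
  have h₂ := (θ ⟨(y, z), hyz⟩).2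
  rw [← h.1, h'.1] at h₂
  exact lt_asymm h₁ h₂

/-- If the triples had mixed types, matching the endpoints of the images would force some image pair
to have equal endpoints. -/
lemma isIncTriple_congr {θ : Equiv.Perm (LtPair X)} (hθ : IsMonotoneOnTriples θ)
    {x y z w : X} (hxy : x < y) (hyz : y < z) (hzw : z < w) :
    (IsIncTriple θ hxy (hyz.trans hzw) ↔ IsIncTriple θ hyz hzw) ∧
    (IsIncTriple θ hxy (hyz.trans hzw) ↔ IsIncTriple θ (hxy.trans hyz) hzw) := by
  have t₁ := hθ hxy hyz
  have t₂ := hθ hyz hzw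
  have t₃ := hθ hxy (hyz.trans hzw)
  have t₄ := hθ (hxy.trans hyz) hzw
  have n₃ := IsIncTriple.not_isDecTriple (θ := θ) (hxy := hxy) (hyz := hyz.trans hzw)
  have n₂ := IsIncTriple.not_isDecTriple (θ := θ) (hxy := hyz) (hyz := hzw)
  have n₄ := IsIncTriple.not_isDecTriple (θ := θ) (hxy := hxy.trans hyz) (hyz := hzw)
  have l₁ := (θ ⟨(x, y), hxy⟩).2
  have l₂ := (θ ⟨(y, z), hyz⟩).2
  have l₃ := (θ ⟨(z, w), hzw⟩).2
  have l₄ := (θ ⟨(x, z), hxy.trans hyz⟩).2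
  have l₅ := (θ ⟨(y, w), hyz.trans hzw⟩).2
  have l₆ := (θ ⟨(x, w), hxy.trans (hyz.trans hzw)⟩).2
  unfold IsIncTriple IsDecTriple at *
  generalize θ ⟨(x, y), hxy⟩ = a at *
  generalize θ ⟨(y, z), hyz⟩ = b at *
  generalize θ ⟨(z, w), hzw⟩ = c at *
  generalize θ ⟨(x, z), hxy.trans hyz⟩ = d at *
  generalize θ ⟨(y, w), hyz.trans hzw⟩ = e at *
  generalize θ ⟨(x, w), hxy.trans (hyz.trans hzw)⟩ = f at *
  obtain ⟨⟨a₁, a₂⟩, ha⟩ := a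
  obtain ⟨⟨b₁, b₂⟩, hb⟩ := b
  obtain ⟨⟨c₁, c₂⟩, hc⟩ := c
  obtain ⟨⟨d₁, d₂⟩, hd⟩ := d
  obtain ⟨⟨e₁, e₂⟩, he⟩ := e
  obtain ⟨⟨f₁, f₂⟩, hf⟩ := f
  simp only [Prod.mk.injEq] at *
  clear ha hb hc hd he hf
  grind

/-- `θ` maps the pairs of a chain to the pairs of another one, preserving or reversing the
order. -/
lemma exists_map_of_isChain {θ : Equiv.Perm (LtPair X)} (hθ : IsMonotoneOnTriples θ)
    {C : Set X} (hC : IsChain (· ≤ ·) C) (hfin : C.Finite) :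
    ∃ f : X → X,
      (∀ (x y : X) (h : x < y), x ∈ C → y ∈ C → (θ ⟨(x, y), h⟩).1 = (f x, f y)) ∨
      (∀ (x y : X) (h : x < y), x ∈ C → y ∈ C → (θ ⟨(x, y), h⟩).1 = (f y, f x)) := by
  classical
  rcases C.eq_empty_or_nonempty with rfl | hne
  · exact ⟨id, by simp⟩
  obtain ⟨b, hb, hbmin⟩ := hfin.exists_minimal hne
  obtain ⟨t, ht, htmax⟩ := hfin.exists_maximal hne
  have hbot : ∀ x ∈ C, b ≤ x := fun x hx =>
    (hC.total hb hx).elim id fun h => hbmin hx h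
  have htop : ∀ x ∈ C, x ≤ t := fun x hx =>
    (hC.total ht hx).elim (fun h => htmax hx h) id
  clear hbmin htmax
  by_cases hinc : ∀ (x y : X) (hxy : x < y) (hyt : y < t), x ∈ C → y ∈ C → IsIncTriple θ hxy hyt
  -- The image of `x < t` is read off from the pair `(x, t)`, and that of `t` from `(b, t)`. The
  -- final default never matters: a strict pair in `C` forces `b < t`.
  · refine ⟨fun x => if h : x < t then (θ ⟨(x, t), h⟩).1.1 else
      if h : b < t then (θ ⟨(b, t), h⟩).1.2 else x, Or.inl fun x y hxy hx hy => ?_⟩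
    have hxt : x < t := hxy.trans_le (htop y hy)
    rcases (htop y hy).lt_or_eq with hyt | rfl
    · have := hinc x y hxy hyt hx hy
      simp only [hxt, hyt, dif_pos]
      ext
      · simp [this.2]
      · exact this.1
    · have hby : b < y := (hbot x hx).trans_lt hxy
      simp only [hxt, lt_irrefl, dif_neg, hby, dif_pos, not_false_eq_true]
      ext
      · rfl
      · rcases (hbot x hx).eq_or_lt with rfl | hbx
        · rfl
        · have := hinc b x hbx hxt hb hx
          simp [this.2]
  · have hdec : ∀ (x y : X) (hxy : x < y) (hyt : y < t), x ∈ C → y ∈ C →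
        IsDecTriple θ hxy hyt := by
      push Not at hinc
      obtain ⟨x₀, y₀, hxy₀, hyt₀, hx₀, hy₀, hn⟩ := hinc
      -- One triple that is not increasing decides all of them: the type of `x < y < t` equals that
      -- of `b < y < t`, which by `key₂` does not depend on `y`.
      have key : ∀ (x y : X) (hxy : x < y) (hyt : y < t) (hby : b < y), x ∈ C → y ∈ C →
          (IsIncTriple θ hxy hyt ↔ IsIncTriple θ hby hyt) := by
        intro x y hxy hyt hby hx hy
        rcases (hbot x hx).eq_or_lt with rfl | hbx
        · rfl
        · have := isIncTriple_congr hθ hbx hxy hyt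
          exact this.1.symm.trans this.2
      have key₂ : ∀ (x y : X) (hbx : b < x) (hxt : x < t) (hby : b < y) (hyt : y < t),
          x ∈ C → y ∈ C → (IsIncTriple θ hbx hxt ↔ IsIncTriple θ hby hyt) := by
        intro x y hbx hxt hby hyt hx hy
        rcases hC.total hx hy with h | h
        · rcases h.eq_or_lt with rfl | h
          · rfl
          · exact (isIncTriple_congr hθ hbx h hyt).2
        · rcases h.eq_or_lt with rfl | h
          · rfl
          · exact (isIncTriple_congr hθ hby h hxt).2.symm
      intro x y hxy hyt hx hy
      refine (hθ hxy hyt).resolve_left fun h => hn ?_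
      have hby := (hbot x hx).trans_lt hxy
      have hby₀ := (hbot x₀ hx₀).trans_lt hxy₀
      exact (key _ _ hxy₀ hyt₀ hby₀ hx₀ hy₀).2
        ((key₂ _ _ hby hyt hby₀ hyt₀ hy hy₀).1 ((key _ _ hxy hyt hby hx hy).1 h))
    refine ⟨fun x => if h : x < t then (θ ⟨(x, t), h⟩).1.2 else
      if h : b < t then (θ ⟨(b, t), h⟩).1.1 else x, Or.inr fun x y hxy hx hy => ?_⟩
    have hxt : x < t := hxy.trans_le (htop y hy)
    rcases (htop y hy).lt_or_eq with hyt | rfl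
    · have := hdec x y hxy hyt hx hy
      simp only [hxt, hyt, dif_pos]
      ext
      · exact this.1.symm
      · simp [this.2]
    · have hby : b < y := (hbot x hx).trans_lt hxy
      simp only [hxt, lt_irrefl, dif_neg, hby, dif_pos, not_false_eq_true]
      ext
      · rcases (hbot x hx).eq_or_lt with rfl | hbx
        · rfl
        · have := hdec b x hbx hxt hb hx
          simp [this.2]
      · rfl

/-- The image of a maximal chain under the map induced by `θ` is a maximal chain. -/
lemma isMaxChain_image [Finite X] {θ : Equiv.Perm (LtPair X)}
    (hθ' : IsMonotoneOnTriples θ.symm) {C : Set X} (hC : IsMaxChain (· ≤ ·) C)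
    (hC2 : C.Nontrivial) {f : X → X}
    (hf : (∀ (x y : X) (h : x < y), x ∈ C → y ∈ C → (θ ⟨(x, y), h⟩).1 = (f x, f y)) ∨
      (∀ (x y : X) (h : x < y), x ∈ C → y ∈ C → (θ ⟨(x, y), h⟩).1 = (f y, f x))) :
    IsMaxChain (· ≤ ·) (f '' C) := by
  have hlt : ∀ x y, x < y → x ∈ C → y ∈ C → f x < f y ∨ f y < f x := by
    intro x y h hx hy
    have h₁ := (θ ⟨(x, y), h⟩).2
    rcases hf with hf | hf <;> rw [hf x y h hx hy] at h₁
    · exact Or.inl h₁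
    · exact Or.inr h₁
  have hne : ∀ x y, x ∈ C → y ∈ C → x ≠ y → f x < f y ∨ f y < f x := by
    intro x y hx hy hxy
    rcases hC.1.total hx hy with h | h
    · exact hlt x y (h.lt_of_ne hxy) hx hy
    · exact (hlt y x (h.lt_of_ne' hxy) hy hx).symm
  refine ⟨?_, fun T hT hsub => ?_⟩
  · rintro _ ⟨x, hx, rfl⟩ _ ⟨y, hy, rfl⟩ hxy
    exact (hne x y hx hy fun h => hxy (h ▸ rfl)).imp le_of_lt le_of_lt
  -- A chain `T` containing `f '' C` is pulled back along `θ⁻¹`. Its image `g '' T` is a chain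
  -- containing `C`, so it equals `C` by maximality; injectivity of `f` and `g` then gives `T` and
  -- `f '' C` the same cardinality.
  obtain ⟨g, hg⟩ := exists_map_of_isChain hθ' hT T.toFinite
  have hgne : ∀ x y, x ∈ T → y ∈ T → x ≠ y → g x < g y ∨ g y < g x := by
    have hg' : ∀ x y, x < y → x ∈ T → y ∈ T → g x < g y ∨ g y < g x := by
      intro x y h hx hy
      have h₁ := (θ.symm ⟨(x, y), h⟩).2
      rcases hg with hg | hg <;> rw [hg x y h hx hy] at h₁
      · exact Or.inl h₁
      · exact Or.inr h₁
    intro x y hx hy hxy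
    rcases hT.total hx hy with h | h
    · exact hg' x y (h.lt_of_ne hxy) hx hy
    · exact (hg' y x (h.lt_of_ne' hxy) hy hx).symm
  have hgchain : IsChain (· ≤ ·) (g '' T) := by
    rintro _ ⟨x, hx, rfl⟩ _ ⟨y, hy, rfl⟩ hxy
    exact (hgne x y hx hy fun h => hxy (h ▸ rfl)).imp le_of_lt le_of_lt
  have hpair : ∀ x y, x < y → x ∈ C → y ∈ C → x ∈ g '' T ∧ y ∈ g '' T := by
    intro x y h hx hy
    have hfx := hsub ⟨x, hx, rfl⟩
    have hfy := hsub ⟨y, hy, rfl⟩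
    have aux : ∀ a b : X, a ∈ T → b ∈ T → (θ ⟨(x, y), h⟩).1 = (a, b) →
        x ∈ g '' T ∧ y ∈ g '' T := by
      intro a b ha hb hab
      have hlt : a < b := by
        have := (θ ⟨(x, y), h⟩).2
        rwa [hab] at this
      have hs : θ.symm ⟨(a, b), hlt⟩ = ⟨(x, y), h⟩ := by
        rw [Equiv.symm_apply_eq]
        exact Subtype.ext hab.symm
      rcases hg with hg | hg
      · have := hg a b hlt ha hb
        rw [hs, Prod.mk.injEq] at this
        exact ⟨⟨a, ha, this.1.symm⟩, ⟨b, hb, this.2.symm⟩⟩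
      · have := hg a b hlt ha hb
        rw [hs, Prod.mk.injEq] at this
        exact ⟨⟨b, hb, this.1.symm⟩, ⟨a, ha, this.2.symm⟩⟩
    rcases hf with hf | hf
    · exact aux _ _ hfx hfy (hf x y h hx hy)
    · exact aux _ _ hfy hfx (hf x y h hx hy)
  have hCsub : C ⊆ g '' T := by
    intro x hx
    obtain ⟨y, hy, hxy⟩ := hC2.exists_ne x
    rcases hC.1.total hx hy with h | h
    · exact (hpair x y (h.lt_of_ne' hxy) hx hy).1
    · exact (hpair y x (h.lt_of_ne hxy) hy hx).2
  have hCeq : C = g '' T := hC.2 hgchain hCsub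
  have hinj : Set.InjOn f C := fun x hx y hy hxy => by
    by_contra hne'
    exact (hne x y hx hy hne').elim (fun h => h.ne hxy) fun h => h.ne' hxy
  have hginj : Set.InjOn g T := fun x hx y hy hxy => by
    by_contra hne'
    exact (hgne x y hx hy hne').elim (fun h => h.ne hxy) fun h => h.ne' hxy
  refine Set.eq_of_subset_of_ncard_le hsub ?_ T.toFinite
  rw [hinj.ncard_image, hCeq, hginj.ncard_image]

lemma IsMonotoneOnTriples.isMonotoneOnMaximalChains [Finite X] {θ : Equiv.Perm (LtPair X)}
    (hθ : IsMonotoneOnTriples θ) (hθ' : IsMonotoneOnTriples θ.symm) :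
    IsMonotoneOnMaximalChains θ := by
  intro m u hu
  -- A chain with at most one element contains no pairs, so it serves as its own image.
  by_cases hm : m ≤ 1
  · refine Or.inl ⟨u, hu, fun i j hij => ?_⟩
    omega
  have hnt : (Set.range u).Nontrivial :=
    ⟨u ⟨0, by omega⟩, ⟨_, rfl⟩, u ⟨1, by omega⟩, ⟨_, rfl⟩,
      (hu.strictMono (Fin.mk_lt_mk.2 zero_lt_one)).ne⟩
  obtain ⟨f, hf⟩ := exists_map_of_isChain hθ hu.isMaxChain.1 (Set.toFinite _)
  have hmax := isMaxChain_image hθ' hu.isMaxChain hnt hf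
  rw [← Set.range_comp] at hmax
  rcases hf with hf | hf
  · have h : ∀ (i j : Fin m) (hij : i < j),
        (θ ⟨(u i, u j), hu.strictMono hij⟩).1 = (f (u i), f (u j)) :=
      fun i j hij => hf _ _ (hu.strictMono hij) ⟨i, rfl⟩ ⟨j, rfl⟩
    refine Or.inl ⟨f ∘ u, ⟨fun i j hij => ?_, hmax⟩, h⟩
    have := (θ ⟨(u i, u j), hu.strictMono hij⟩).2
    rwa [h i j hij] at this
  · have h : ∀ (i j : Fin m) (hij : i < j),
        (θ ⟨(u i, u j), hu.strictMono hij⟩).1 = (f (u j), f (u i)) :=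
      fun i j hij => hf _ _ (hu.strictMono hij) ⟨i, rfl⟩ ⟨j, rfl⟩
    refine Or.inr ⟨f ∘ u ∘ Fin.rev, ⟨fun i j hij => ?_, ?_⟩, fun i j hij => ?_⟩
    · have := (θ ⟨(u j.rev, u i.rev), hu.strictMono (Fin.rev_lt_rev.2 hij)⟩).2
      rwa [h _ _ (Fin.rev_lt_rev.2 hij)] at this
    · rw [← Function.comp_assoc, Fin.rev_surjective.range_comp]
      exact hmax
    · simp [h i j hij]

end Chains

/-! ### Linear relations between difference functionals -/

section Differences

variable {K X : Type*} [Field K] [PartialOrder X]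

/-- Pairs with proportional difference functionals are equal. -/
lemma LtPair.eq_of_forall_imp {p q : LtPair X}
    (h : ∀ d : X → K, d p.1.1 = d p.1.2 → d q.1.1 = d q.1.2) : p = q := by
  classical
  -- The indicator of either end of `q` separates the ends of `q`, hence those of `p`. So both pairs
  -- have the same two ends, and the order fixes which comes first.
  have h' := fun t => h fun s => if s = t then 1 else 0
  have hp := p.2
  have hq := q.2
  obtain ⟨⟨x, y⟩, hxy⟩ := p
  obtain ⟨⟨u, v⟩, huv⟩ := q
  simp only [Subtype.mk.injEq, Prod.mk.injEq] at *
  have h₁ := h' u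
  have h₂ := h' v
  have hne := huv.ne
  have hne' := huv.ne'
  simp only [if_true, hne, hne', if_false] at h₁ h₂
  grind

/-- A linear relation between the difference functionals of three pairs, two of which are not
composable with the third one, comes from a chain of three elements. -/
lemma LtPair.chain_of_relation {p q r : LtPair X} {a b e : K} (ha : a ≠ 0) (hb : b ≠ 0)
    (he : e ≠ 0) (hpr : p ≠ r) (hqr : q ≠ r) (cpr : ¬ Composable p r) (cqr : ¬ Composable q r)
    (h : ∀ d : X → K, a * (d r.1.1 - d r.1.2) =
      b * (d p.1.1 - d p.1.2) + e * (d q.1.1 - d q.1.2)) :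
    a = b ∧ a = e ∧ ((p.1.2 = q.1.1 ∧ r.1 = (p.1.1, q.1.2)) ∨
      (q.1.2 = p.1.1 ∧ r.1 = (q.1.1, p.1.2))) := by
  classical
  have h' := fun t => h fun s => if s = t then 1 else 0
  clear h
  obtain ⟨⟨p₁, p₂⟩, hp⟩ := p
  obtain ⟨⟨q₁, q₂⟩, hq⟩ := q
  obtain ⟨⟨r₁, r₂⟩, hr⟩ := r
  simp only [Composable, not_or, ne_eq, Subtype.mk.injEq, Prod.mk.injEq] at *
  have hp' := hp.ne
  have hq' := hq.ne
  have hr' := hr.ne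
  -- Evaluate at the indicators of `r₁` and `r₂`. Non-composability removes the contributions of
  -- opposite sign, so `r₁` is the start and `r₂` the end of `p` or `q`. Neither pair can supply
  -- both, and the two remaining ends must cancel.
  have h₁ : a = b * (if p₁ = r₁ then 1 else 0) + e * (if q₁ = r₁ then 1 else 0) := by
    simpa [hr'.symm, cpr.1, cqr.1] using h' r₁
  have h₂ : a = b * (if p₂ = r₂ then 1 else 0) + e * (if q₂ = r₂ then 1 else 0) := by
    have := h' r₂
    simp only [hr', Ne.symm cpr.2, Ne.symm cqr.2, if_true, if_false] at this
    linear_combination -this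
  have hA : p₁ = r₁ ∨ q₁ = r₁ := by
    by_contra! hn
    simp [hn.1, hn.2, ha] at h₁
  have hB : p₂ = r₂ ∨ q₂ = r₂ := by
    by_contra! hn
    simp [hn.1, hn.2, ha] at h₂
  rcases hA with rfl | rfl
  · have hB' := hB.resolve_left fun hn => hpr ⟨rfl, hn⟩
    subst hB'
    have h₃ : p₂ ≠ q₂ := fun hn => hpr ⟨rfl, hn⟩
    have h₄ : q₁ ≠ p₁ := fun hn => hqr ⟨hn, rfl⟩
    refine ⟨by simpa [h₄] using h₁, by simpa [h₃] using h₂, Or.inl ⟨?_, rfl, rfl⟩⟩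
    by_contra hn
    have := h' p₂
    simp [hp', h₃.symm, Ne.symm hn, hb] at this
  · have hB' := hB.resolve_right fun hn => hqr ⟨rfl, hn⟩
    subst hB'
    have h₃ : q₂ ≠ p₂ := fun hn => hqr ⟨rfl, hn⟩
    have h₄ : p₁ ≠ q₁ := fun hn => hpr ⟨hn, rfl⟩
    refine ⟨by simpa [h₃] using h₂, by simpa [h₄] using h₁, Or.inr ⟨?_, rfl, rfl⟩⟩
    by_contra hn
    have := h' q₂
    simp [hq', h₃.symm, Ne.symm hn, he] at this

end Differences

/-! ### The long pair of a triple -/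

section LongPair

variable {X : Type*} [PartialOrder X]

lemma LtPair.long_pair {x y z : X} (hxy : x < y) (hyz : y < z) :
    (⟨(x, y), hxy⟩ : LtPair X) ≠ ⟨(x, z), hxy.trans hyz⟩ ∧
    (⟨(y, z), hyz⟩ : LtPair X) ≠ ⟨(x, z), hxy.trans hyz⟩ ∧
    ¬ Composable (⟨(x, y), hxy⟩ : LtPair X) ⟨(x, z), hxy.trans hyz⟩ ∧
    ¬ Composable (⟨(y, z), hyz⟩ : LtPair X) ⟨(x, z), hxy.trans hyz⟩ := by
  simp [Composable, hxy.ne', hyz.ne, hyz.ne', (hxy.trans hyz).ne']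

end LongPair

/-! ### The monomial form of a preserver -/

section Decomposition

variable {K X : Type*} [Field K] [PartialOrder X] [DecidableEq X]

/-- `φ` acts on the diagonal elements by `Φ`, sends `e_p` to `σ(p) e_{θ(p)}` plus the diagonal
element `A(p)`, and `c` relates the differences of the diagonal entries at `p` and at `θ(p)`. -/
structure IsMonomial (φ : IncidenceAlgebra K X →ₗ[K] IncidenceAlgebra K X)
    (θ : Equiv.Perm (LtPair X)) (σ c : LtPair X → Kˣ) (A : LtPair X → X → K)
    (Φ : (X → K) →ₗ[K] (X → K)) : Prop where
  diag : ∀ d, φ (diagElem d) = diagElem (Φ d)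
  surjective : Function.Surjective Φ
  pair : ∀ p, φ (eLt K p) = diagElem (A p) + (σ p : K) • eLt K (θ p)
  diff : ∀ p d, Φ d (θ p).1.1 - Φ d (θ p).1.2 = c p * (d p.1.1 - d p.1.2)

variable [LocallyFiniteOrder X] {φ : IncidenceAlgebra K X →ₗ[K] IncidenceAlgebra K X}

/-- Commutation with the diagonal determines the kernel of `δ_p`, and this kernel determines `p`;
the strong condition is used only between diagonal elements and the `e_p`. -/
lemma exists_isMonomial [Finite X] (hinj : Function.Injective φ)
    (hstrong : IsStrongCommPreserver φ) (hdiag : PreservesDiagonal φ) :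
    ∃ θ σ c A Φ, IsMonomial φ θ σ c A Φ := by
  have := Fintype.ofFinite X
  let Φ : (X → K) →ₗ[K] (X → K) :=
    { toFun d x := φ (diagElem d) x x
      map_add' _ _ := by ext; simp
      map_smul' _ _ := by ext; simp }
  have hΦ : ∀ d, φ (diagElem d) = diagElem (Φ d) := fun d =>
    eq_diagElem_of_mem (hdiag _ (diagElem_mem d))
  have hΦinj : Function.Injective Φ := fun d d' h => by
    have h₁ : diagElem d = diagElem d' := hinj (by rw [hΦ, hΦ, h])
    ext x
    rw [← diagElem_apply_self d, h₁, diagElem_apply_self]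
  have hΦsurj : Function.Surjective Φ := LinearMap.injective_iff_surjective.1 hΦinj
  have hcomm : ∀ p d, d p.1.1 = d p.1.2 ↔
      ∀ q, evalPair q (φ (eLt K p)) ≠ 0 → Φ d q.1.1 = Φ d q.1.2 := by
    intro p d
    rw [← diagElem_lie_eq_zero_iff, ← hΦ, ← hstrong, diagElem_lie_eq_zero_iff]
    constructor
    · intro h q hq
      rw [evalPair_eLt] at hq
      obtain rfl : q = p := by_contra fun h => hq (if_neg h)
      exact h
    · intro h
      exact h p (by simp)
  have hc : ∀ p q, evalPair q (φ (eLt K p)) ≠ 0 →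
      ∃ c : Kˣ, ∀ d, Φ d q.1.1 - Φ d q.1.2 = c * (d p.1.1 - d p.1.2) := by
    intro p q hq
    have h : ∀ d, Φ d q.1.1 - Φ d q.1.2 =
        (Φ (Pi.single p.1.1 1) q.1.1 - Φ (Pi.single p.1.1 1) q.1.2) * (d p.1.1 - d p.1.2) := by
      intro d
      -- The correction at the first end of `p` gives the function equal values at both ends.
      have := (hcomm p (d - (d p.1.1 - d p.1.2) • Pi.single p.1.1 1)).1
        (by simp [p.2.ne']) q hq
      simp only [map_sub, map_smul, Pi.sub_apply, Pi.smul_apply, smul_eq_mul] at this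
      linear_combination this
    refine ⟨Units.mk0 _ fun h0 => ?_, h⟩
    obtain ⟨d, hd⟩ := hΦsurj (Pi.single q.1.1 1)
    have := h d
    rw [h0, hd] at this
    simp [q.2.ne'] at this
  -- A diagonal `φ(e_p)` would commute with every diagonal element, hence so would `e_p`.
  have hex : ∀ p, ∃ q, evalPair q (φ (eLt K p)) ≠ 0 := by
    intro p
    by_contra! hn
    have := (hcomm p (Pi.single p.1.1 1)).2 fun q hq => absurd (hn q) hq
    simp [p.2.ne'] at this
  choose θ hθ using hex
  choose c hc' using fun p => hc p (θ p) (hθ p)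
  have hθinj : Function.Injective θ := by
    intro p q hpq
    refine LtPair.eq_of_forall_imp (K := K) fun d hd => ?_
    have h₁ := hc' p d
    rw [hpq, hc' q d, hd, sub_self, mul_zero] at h₁
    exact sub_eq_zero.1 ((mul_eq_zero.1 h₁).resolve_left (c q).ne_zero)
  refine ⟨Equiv.ofBijective θ (Finite.injective_iff_bijective.1 hθinj),
    fun p => Units.mk0 _ (hθ p), c, fun p x => φ (eLt K p) x x, Φ, hΦ, hΦsurj, fun p => ?_, hc'⟩
  apply ext_pair
  · intro x
    simp [diagElem_apply_self, eLt_apply_self_self]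
  · intro q
    simp only [Equiv.ofBijective_apply, Units.val_mk0, map_add, map_smul, evalPair_diagElem,
      evalPair_eLt, smul_eq_mul, zero_add]
    split_ifs with h
    · rw [h, mul_one]
    · rw [mul_zero]
      by_contra hq
      refine h (LtPair.eq_of_forall_imp (K := K) fun d' hd' => ?_)
      obtain ⟨d, rfl⟩ := hΦsurj d'
      obtain ⟨k, hk⟩ := hc p q hq
      have h₁ := hk d
      rw [hd', sub_self, eq_comm, mul_eq_zero] at h₁
      rw [← sub_eq_zero, hc' p d, h₁.resolve_left k.ne_zero, mul_zero]

attribute [local instance] LieRing.ofAssociativeRing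

lemma lie_diagElem_add_smul (a b : X → K) (s t : K) (p q : LtPair X) :
    ⁅diagElem a + s • eLt K p, diagElem b + t • eLt K q⁆ =
      (t * (a q.1.1 - a q.1.2)) • eLt K q - (s * (b p.1.1 - b p.1.2)) • eLt K p +
        (s * t) • ⁅eLt K p, eLt K q⁆ := by
  rw [add_lie, lie_add, lie_add, smul_lie, smul_lie, lie_smul, lie_smul, diagElem_lie_diagElem,
    diagElem_lie_eLt, eLt_lie_diagElem, smul_neg, smul_smul, smul_smul, smul_smul]
  abel

namespace IsMonomial

variable {θ : Equiv.Perm (LtPair X)} {σ c : LtPair X → Kˣ} {A : LtPair X → X → K}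
  {Φ : (X → K) →ₗ[K] (X → K)}

/-- The bracket of the images is a combination of `e_{θ(p)}`, `e_{θ(q)}` and their bracket, which
has no component at either pair; so the three parts vanish separately. -/
lemma of_not_composable (h : IsMonomial φ θ σ c A Φ) (hstrong : IsStrongCommPreserver φ)
    {p q : LtPair X} (hpq : p ≠ q) (hc : ¬ Composable p q) :
    A p (θ q).1.1 - A p (θ q).1.2 = 0 ∧ A q (θ p).1.1 - A q (θ p).1.2 = 0 ∧
      ¬ Composable (θ p) (θ q) := by
  have h₀ := (hstrong _ _).1 (eLt_lie_eLt_eq_zero (K := K) hc)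
  rw [h.pair, h.pair, lie_diagElem_add_smul] at h₀
  have hne : θ p ≠ θ q := θ.injective.ne hpq
  have h₁ : A p (θ q).1.1 - A p (θ q).1.2 = 0 := by
    have := congrArg (evalPair (θ q)) h₀
    simpa [evalPair_lie_of_right, hne.symm] using this
  have h₂ : A q (θ p).1.1 - A q (θ p).1.2 = 0 := by
    have := congrArg (evalPair (θ p)) h₀
    simpa [evalPair_lie_of_left, hne] using this
  refine ⟨h₁, h₂, fun hn => eLt_lie_eLt_ne_zero (K := K) hn ?_⟩
  simpa [h₁, h₂] using h₀

/-- Since `δ_p = c(p)⁻¹ δ_{θ(p)} ∘ Φ` and `Φ` is surjective, `δ_{xz} = δ_{xy} + δ_{yz}` becomes a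
relation between the image pairs. The long pair composes with neither short one, and `θ` keeps this,
so `LtPair.chain_of_relation` applies. -/
lemma triple (h : IsMonomial φ θ σ c A Φ) (hstrong : IsStrongCommPreserver φ)
    {x y z : X} (hxy : x < y) (hyz : y < z) :
    c ⟨(x, z), hxy.trans hyz⟩ = c ⟨(x, y), hxy⟩ ∧ c ⟨(x, z), hxy.trans hyz⟩ = c ⟨(y, z), hyz⟩ ∧
      (IsIncTriple θ hxy hyz ∨ IsDecTriple θ hxy hyz) := by
  obtain ⟨hpr, hqr, cpr, cqr⟩ := LtPair.long_pair hxy hyz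
  obtain ⟨h₁, h₂, h₃⟩ := LtPair.chain_of_relation
    (inv_ne_zero (c ⟨(x, z), hxy.trans hyz⟩).ne_zero)
    (inv_ne_zero (c ⟨(x, y), hxy⟩).ne_zero) (inv_ne_zero (c ⟨(y, z), hyz⟩).ne_zero)
    (θ.injective.ne hpr) (θ.injective.ne hqr) (h.of_not_composable hstrong hpr cpr).2.2
    (h.of_not_composable hstrong hqr cqr).2.2 (fun d => by
      obtain ⟨d, rfl⟩ := h.surjective d
      simp only [h.diff, inv_mul_cancel_left₀ (Units.ne_zero _)]
      ring)
  exact ⟨Units.ext (inv_injective h₁), Units.ext (inv_injective h₂), h₃⟩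

lemma isMonotoneOnTriples (h : IsMonomial φ θ σ c A Φ) (hstrong : IsStrongCommPreserver φ) :
    IsMonotoneOnTriples θ := fun _ _ _ hxy hyz => (h.triple hstrong hxy hyz).2.2

lemma isMonotoneOnTriples_symm (h : IsMonomial φ θ σ c A Φ)
    (hstrong : IsStrongCommPreserver φ) : IsMonotoneOnTriples θ.symm := by
  -- Here non-composability of the preimages follows from `θ` preserving composability on triples.
  have hcomp : ∀ {p q}, Composable (θ.symm p) (θ.symm q) → Composable p q := by
    have key : ∀ p q : LtPair X, p.1.2 = q.1.1 → Composable (θ p) (θ q) := by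
      rintro ⟨⟨x, y⟩, hxy⟩ ⟨⟨y', z⟩, hyz⟩ (rfl : y = y')
      exact (h.isMonotoneOnTriples hstrong hxy hyz).imp And.left And.left
    intro p q hpq
    rcases hpq with hpq | hpq
    · simpa using key _ _ hpq
    · simpa [Composable, or_comm] using key _ _ hpq
  have hdiff : ∀ p d, (c (θ.symm p) : K) * (d (θ.symm p).1.1 - d (θ.symm p).1.2) =
      Φ d p.1.1 - Φ d p.1.2 := fun p d => by
    rw [← h.diff, Equiv.apply_symm_apply]
  intro x y z hxy hyz
  obtain ⟨hpr, hqr, cpr, cqr⟩ := LtPair.long_pair hxy hyz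
  exact (LtPair.chain_of_relation (c _).ne_zero (c _).ne_zero (c _).ne_zero
    (θ.symm.injective.ne hpr) (θ.symm.injective.ne hqr) (mt hcomp cpr) (mt hcomp cqr)
    (fun d => by
      rw [hdiff, hdiff, hdiff]
      ring)).2.2

/-- A strong preserver controls only zero brackets, so the nonzero `[e_{xy}, e_{yz}] = e_{xz}` is
cancelled by a bracket with a diagonal element, whose image is known. -/
lemma lie_pair (h : IsMonomial φ θ σ c A Φ) (hstrong : IsStrongCommPreserver φ)
    {x y z : X} (hxy : x < y) (hyz : y < z) :
    ⁅φ (eLt K ⟨(x, y), hxy⟩), φ (eLt K ⟨(y, z), hyz⟩)⁆ =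
      ((c ⟨(x, z), hxy.trans hyz⟩ : K) * σ ⟨(x, z), hxy.trans hyz⟩) •
        eLt K (θ ⟨(x, z), hxy.trans hyz⟩) := by
  have hxz := hxy.trans hyz
  have cqr : ¬ Composable (⟨(x, z), hxz⟩ : LtPair X) ⟨(y, z), hyz⟩ :=
    fun hc => (LtPair.long_pair hxy hyz).2.2.2 hc.symm
  -- Equal values at `x` and `y` make `b` commute with `e_{xy}`, while `[e_{xz}, b] = -e_{xz}`.
  let b : X → K := Pi.single x 1 + Pi.single y 1
  have hf : ⁅eLt K ⟨(x, y), hxy⟩ + eLt K ⟨(x, z), hxz⟩, eLt K ⟨(y, z), hyz⟩ + diagElem b⁆ = 0 := by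
    rw [add_lie, lie_add, lie_add, eLt_lie_eLt_eq_zero cqr, eLt_lie_diagElem, eLt_lie_diagElem,
      eLt_lie_eLt_of_eq (r := ⟨(x, z), hxz⟩) rfl rfl]
    simp [b, hxy.ne, hxy.ne', hxz.ne', hyz.ne']
  have h₀ := (hstrong _ _).1 hf
  have hr := (hstrong _ _).1 (eLt_lie_eLt_eq_zero (K := K) cqr)
  have hd : ∀ p, ⁅φ (eLt K p), φ (diagElem b)⁆ =
      -(((c p : K) * σ p * (b p.1.1 - b p.1.2)) • eLt K (θ p)) := by
    intro p
    rw [h.pair, h.diag, add_lie, diagElem_lie_diagElem, smul_lie, eLt_lie_diagElem, h.diff,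
      zero_add, smul_neg, smul_smul]
    congr 2
    ring
  rw [map_add, map_add, add_lie, lie_add, lie_add, hr, hd, hd] at h₀
  simp only [b, Pi.add_apply, Pi.single_apply, hxy.ne, hxy.ne', hxz.ne', hyz.ne', if_true,
    if_false] at h₀
  simp only [zero_add, add_zero, sub_self, mul_zero, zero_smul, neg_zero, sub_zero, mul_one] at h₀
  exact add_neg_eq_zero.1 h₀

/-- Coefficients in `lie_pair` are compared: its right side lives at the image of the long pair
only. -/
lemma composable_data (h : IsMonomial φ θ σ c A Φ) (hstrong : IsStrongCommPreserver φ)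
    {x y z : X} (hxy : x < y) (hyz : y < z) :
    A ⟨(x, y), hxy⟩ (θ ⟨(y, z), hyz⟩).1.1 - A ⟨(x, y), hxy⟩ (θ ⟨(y, z), hyz⟩).1.2 = 0 ∧
    A ⟨(y, z), hyz⟩ (θ ⟨(x, y), hxy⟩).1.1 - A ⟨(y, z), hyz⟩ (θ ⟨(x, y), hxy⟩).1.2 = 0 ∧
    ((σ ⟨(x, y), hxy⟩ : K) * σ ⟨(y, z), hyz⟩) •
        ⁅eLt K (θ ⟨(x, y), hxy⟩), eLt K (θ ⟨(y, z), hyz⟩)⁆ =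
      ((c ⟨(x, z), hxy.trans hyz⟩ : K) * σ ⟨(x, z), hxy.trans hyz⟩) •
        eLt K (θ ⟨(x, z), hxy.trans hyz⟩) := by
  have h₀ := h.lie_pair hstrong hxy hyz
  have hpr := θ.injective.ne (LtPair.long_pair hxy hyz).1
  have hqr := θ.injective.ne (LtPair.long_pair hxy hyz).2.1
  have hpq : θ ⟨(x, y), hxy⟩ ≠ θ ⟨(y, z), hyz⟩ := θ.injective.ne (by simp [hxy.ne])
  rw [h.pair, h.pair, lie_diagElem_add_smul] at h₀
  generalize θ ⟨(x, y), hxy⟩ = p at *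
  generalize θ ⟨(y, z), hyz⟩ = q at *
  generalize θ ⟨(x, z), hxy.trans hyz⟩ = r at *
  have h₁ : A ⟨(x, y), hxy⟩ q.1.1 - A ⟨(x, y), hxy⟩ q.1.2 = 0 := by
    have := congrArg (evalPair q) h₀
    simpa [evalPair_lie_of_right, hpq.symm, hqr] using this
  have h₂ : A ⟨(y, z), hyz⟩ p.1.1 - A ⟨(y, z), hyz⟩ p.1.2 = 0 := by
    have := congrArg (evalPair p) h₀
    simpa [evalPair_lie_of_left, hpq, hpr] using this
  refine ⟨h₁, h₂, ?_⟩
  simpa [h₁, h₂] using h₀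

lemma diff_eq_zero (h : IsMonomial φ θ σ c A Φ) (hstrong : IsStrongCommPreserver φ)
    {p q : LtPair X} (hpq : p ≠ q) : A p (θ q).1.1 - A p (θ q).1.2 = 0 := by
  by_cases hc : Composable p q
  · obtain ⟨⟨x, y⟩, hxy⟩ := p
    obtain ⟨⟨u, v⟩, huv⟩ := q
    rcases hc with hc | hc
    · obtain rfl : y = u := hc
      exact (h.composable_data hstrong hxy huv).1
    · obtain rfl : v = x := hc
      exact (h.composable_data hstrong huv hxy).2.1
  · exact (h.of_not_composable hstrong hpq hc).1

lemma eLt_eq_mul {p q r : LtPair X} (h : eLt K r = eLt K p * eLt K q) :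
    p.1.2 = q.1.1 ∧ r.1 = (p.1.1, q.1.2) := by
  have h₁ : p.1.2 = q.1.1 := by
    by_contra hn
    rw [eLt_mul_eLt_of_ne hn] at h
    exact eLt_ne_zero r h
  rw [eLt_mul_eLt_of_eq h₁ (r := ⟨(p.1.1, q.1.2), p.2.trans (h₁ ▸ q.2)⟩) rfl] at h
  exact ⟨h₁, congrArg Subtype.val (eLt_injective h)⟩

lemma isCompatible (h : IsMonomial φ θ σ c A Φ) (hstrong : IsStrongCommPreserver φ) :
    IsCompatible θ σ c := by
  intro x y z hxy hyz
  have h₀ := (h.composable_data hstrong hxy hyz).2.2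
  constructor <;> intro h₁
  · obtain ⟨h₂, h₃⟩ := eLt_eq_mul h₁
    rw [eLt_lie_eLt_of_eq h₂ h₃] at h₀
    exact (smul_left_injective K (eLt_ne_zero _) h₀).symm
  · obtain ⟨h₂, h₃⟩ := eLt_eq_mul h₁
    rw [← lie_skew, eLt_lie_eLt_of_eq h₂ h₃, smul_neg, ← neg_smul] at h₀
    exact (smul_left_injective K (eLt_ne_zero _) h₀).symm

/-- Two pairs of a chain are both compared with the pair from the smaller start to the larger end.
-/
lemma isConstantOnMaximalChains (h : IsMonomial φ θ σ c A Φ)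
    (hstrong : IsStrongCommPreserver φ) : IsConstantOnMaximalChains c := by
  intro m u hu
  have hbot : ∀ (i j b : Fin m) (hij : i < j) (hbi : b ≤ i),
      c ⟨(u i, u j), hu.strictMono hij⟩ = c ⟨(u b, u j), hu.strictMono (hbi.trans_lt hij)⟩ := by
    intro i j b hij hbi
    rcases hbi.eq_or_lt with rfl | hbi
    · rfl
    · exact (h.triple hstrong (hu.strictMono hbi) (hu.strictMono hij)).2.1.symm
  have htop : ∀ (i j t : Fin m) (hij : i < j) (hjt : j ≤ t),
      c ⟨(u i, u j), hu.strictMono hij⟩ = c ⟨(u i, u t), hu.strictMono (hij.trans_le hjt)⟩ := by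
    intro i j t hij hjt
    rcases hjt.eq_or_lt with rfl | hjt
    · rfl
    · exact (h.triple hstrong (hu.strictMono hij) (hu.strictMono hjt)).1.symm
  intro i j k l hij hkl
  rw [hbot i j (min i k) hij (min_le_left _ _),
    htop _ j (max j l) ((min_le_left _ _).trans_lt hij) (le_max_left _ _),
    hbot k l (min i k) hkl (min_le_right _ _),
    htop _ l (max j l) ((min_le_right _ _).trans_lt hkl) (le_max_right _ _)]

end IsMonomial

end Decomposition

/-! ### The shift that absorbs the diagonal parts -/

section Shift

variable {K X : Type*} [Field K] [PartialOrder X] [DecidableEq X]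

open Classical in
/-- The linear map vanishing on the diagonal and sending `e_p` to the diagonal element `B(p)`. -/
noncomputable def shiftOf [Fintype X] (B : LtPair X → X → K) :
    IncidenceAlgebra K X →ₗ[K] diagonal K X :=
  ∑ p : LtPair X, (evalPair p).smulRight (⟨diagElem (B p), diagElem_mem _⟩ : diagonal K X)

variable [Fintype X]

open Classical in
lemma coe_shiftOf (B : LtPair X → X → K) (f : IncidenceAlgebra K X) :
    (shiftOf B f : IncidenceAlgebra K X) = diagElem (∑ p, evalPair p f • B p) := by
  simp [shiftOf, LinearMap.sum_apply, map_sum]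

lemma shiftOf_diagElem (B : LtPair X → X → K) (d : X → K) : shiftOf B (diagElem d) = 0 := by
  ext1
  simp [coe_shiftOf]

lemma shiftOf_eDiag (B : LtPair X → X → K) (z : X) : shiftOf B (eDiag K z) = 0 := by
  rw [eDiag_eq_diagElem, shiftOf_diagElem]

lemma coe_shiftOf_eLt (B : LtPair X → X → K) (p : LtPair X) :
    (shiftOf B (eLt K p) : IncidenceAlgebra K X) = diagElem (B p) := by
  classical
  simp [coe_shiftOf]

variable [LocallyFiniteOrder X]

attribute [local instance] LieRing.ofAssociativeRing

-- The right side is symmetric in `f` and `g`, which drives the cancellation in `shiftMap_lie`.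
open Classical in
lemma shiftOf_lie {B : LtPair X → X → K} (hB : ∀ p q, p ≠ q → B p q.1.1 - B p q.1.2 = 0)
    (f g : IncidenceAlgebra K X) :
    ⁅(shiftOf B f : IncidenceAlgebra K X), g⁆ =
      ∑ p, (evalPair p f * evalPair p g * (B p p.1.1 - B p p.1.2)) • eLt K p := by
  have hsum : ∀ q : LtPair X, (∑ p, evalPair p f • B p) q.1.1 - (∑ p, evalPair p f • B p) q.1.2 =
      evalPair q f * (B q q.1.1 - B q q.1.2) := by
    intro q
    simp only [Finset.sum_apply, Pi.smul_apply, smul_eq_mul, ← Finset.sum_sub_distrib, ← mul_sub]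
    refine Finset.sum_eq_single q (fun p _ hp => ?_) (by simp)
    rw [hB p q hp, mul_zero]
  rw [coe_shiftOf]
  conv_lhs => rw [eq_diagElem_add_sum g]
  rw [lie_add, diagElem_lie_diagElem, zero_add, lie_sum]
  refine Finset.sum_congr rfl fun q _ => ?_
  rw [lie_smul, diagElem_lie_eLt, hsum, smul_smul]
  congr 1
  ring

/-- The cross terms `[α(f), g]` and `[f, α(g)] = -[α(g), f]` cancel by symmetry, and diagonal
elements commute. -/
lemma shiftMap_lie {B : LtPair X → X → K} (hB : ∀ p q, p ≠ q → B p q.1.1 - B p q.1.2 = 0)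
    (f g : IncidenceAlgebra K X) :
    ⁅shiftMap (shiftOf B) f, shiftMap (shiftOf B) g⁆ = ⁅f, g⁆ := by
  classical
  have h₁ : ⁅(shiftOf B f : IncidenceAlgebra K X), g⁆ + ⁅f, (shiftOf B g : IncidenceAlgebra K X)⁆ =
      0 := by
    rw [← lie_skew f, shiftOf_lie hB, shiftOf_lie hB]
    simp only [mul_comm (evalPair _ g)]
    exact add_neg_cancel _
  have h₂ : ⁅(shiftOf B f : IncidenceAlgebra K X), (shiftOf B g : IncidenceAlgebra K X)⁆ = 0 := by
    rw [coe_shiftOf, coe_shiftOf, diagElem_lie_diagElem]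
  simp only [shiftMap, LinearMap.add_apply, LinearMap.id_apply, LinearMap.comp_apply,
    Submodule.subtype_apply, add_lie, lie_add, h₂, add_zero]
  rw [add_assoc, add_comm ⁅f, _⁆, h₁, zero_add]

/-- This `α` kills the diagonal, so the conditions on `α(e_z)` are trivial. -/
lemma isShiftType_shiftOf {B : LtPair X → X → K}
    (hB : ∀ p q, p ≠ q → B p q.1.1 - B p q.1.2 = 0) : IsShiftType (shiftOf B) where
  strong f g := by rw [shiftMap_lie hB]
  lt_lt p q hpq := by rw [coe_shiftOf_eLt, diagElem_lie_eLt, hB p q hpq, zero_smul]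
  diag_lt z p _ := by rw [shiftOf_eDiag, Submodule.coe_zero, zero_lie]
  cover p _ := by
    rw [shiftOf_eDiag, shiftOf_eDiag, Submodule.coe_zero, zero_lie, lie_zero]
  cover_ne p _ := by
    rw [shiftOf_eDiag, Submodule.coe_zero, zero_lie]
    exact (neg_ne_zero.2 (eLt_ne_zero p)).symm

end Shift

/-! ### Telescoping along walks -/

section Walks

variable {K X : Type*} [Field K] [PartialOrder X]

/-- If the differences of `Φ(e_z)` at `θ(p)` are given by `c(p)`, then the increment along a walk is
the difference of the values of `Φ(e_z)` at its two ends. -/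
lemma walkIncrement_eq [DecidableEq X] {θ : Equiv.Perm (LtPair X)} {c : LtPair X → Kˣ} (z : X)
    {F : X → K}
    (hF : ∀ p, F p.1.1 - F p.1.2 = (c (θ.symm p) : K) *
      ((Pi.single z 1 : X → K) (θ.symm p).1.1 - (Pi.single z 1 : X → K) (θ.symm p).1.2))
    {u v : X} (Γ : (SimpleGraph.hasse X).Walk u v) :
    walkIncrement θ c Γ z = F v - F u := by
  induction Γ with
  | nil => simp [walkIncrement, sPlus, sMinus, tPlus, tMinus]
  | @cons u w v hadj Γ ih =>
    simp only [walkIncrement, sPlus, sMinus, tPlus, tMinus, SimpleGraph.Walk.darts_cons,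
      List.map_cons, List.sum_cons] at ih ⊢
    rcases (SimpleGraph.hasse_adj.1 hadj).imp CovBy.lt CovBy.lt with h | h
    · have h' := h.not_gt
      have hp := hF ⟨(u, w), h⟩
      simp only [Pi.single_apply] at hp
      simp only [h, h', dif_pos, dif_neg, not_false_eq_true]
      -- The cases ask which end of the preimage of the step is `z`; in each, the head terms add up
      -- to the change of `F` across the step.
      split_ifs at hp ⊢ <;> linear_combination ih + hp
    · have h' := h.not_gt
      have hp := hF ⟨(w, u), h⟩
      simp only [Pi.single_apply] at hp
      simp only [h, h', dif_pos, dif_neg, not_false_eq_true]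
      split_ifs at hp ⊢ <;> linear_combination ih - hp

lemma isAdmissible_of_diff [DecidableEq X] {θ : Equiv.Perm (LtPair X)} {c : LtPair X → Kˣ}
    {F : X → X → K}
    (hF : ∀ z p, F z p.1.1 - F z p.1.2 = (c (θ.symm p) : K) *
      ((Pi.single z 1 : X → K) (θ.symm p).1.1 - (Pi.single z 1 : X → K) (θ.symm p).1.2)) :
    IsAdmissible θ c := by
  intro u Γ z
  have := walkIncrement_eq z (hF z) Γ
  rw [walkIncrement, sub_self] at this
  linear_combination -this

end Walks

/-! ### Functions constant along covers -/

section Connected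

variable {K X : Type*} [PartialOrder X]

lemma eq_of_connected {F : X → K} (hconn : (SimpleGraph.hasse X).Connected)
    (hF : ∀ p : LtPair X, F p.1.1 = F p.1.2) (u v : X) : F u = F v := by
  obtain ⟨Γ⟩ := hconn.preconnected u v
  induction Γ with
  | nil => rfl
  | @cons u w v hadj Γ ih =>
    rw [← ih]
    rcases SimpleGraph.hasse_adj.1 hadj with h | h
    · exact hF ⟨(u, w), h.lt⟩
    · exact (hF ⟨(w, u), h.lt⟩).symm

end Connected

/-! ### Values of `τ` on the basis -/

section Tau

variable {K X : Type*} [Field K] [PartialOrder X] [Fintype X] [DecidableEq X]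

lemma tau_eLt (hconn : (SimpleGraph.hasse X).Connected) (x₁ : X) (θ : Equiv.Perm (LtPair X))
    (σ c : LtPair X → Kˣ) (κ : X → K) (p : LtPair X) :
    tau hconn x₁ θ σ c κ (eLt K p) = (σ p : K) • eLt K (θ p) := by
  simp only [tau, LinearMap.coe_mk, AddHom.coe_mk, eLt_apply_self_self, eLt_apply_pair, zero_smul,
    Finset.sum_const_zero, zero_add]
  rw [Finset.sum_eq_single p] <;> simp +contextual

lemma tau_eDiag (hconn : (SimpleGraph.hasse X).Connected) (x₁ : X) (θ : Equiv.Perm (LtPair X))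
    (σ c : LtPair X → Kˣ) (κ : X → K) (z : X) :
    tau hconn x₁ θ σ c κ (eDiag K z) =
      diagElem fun v => κ z + walkIncrement θ c (hconn.preconnected x₁ v).some z := by
  simp only [tau, LinearMap.coe_mk, AddHom.coe_mk, eDiag_eq_diagElem, diagElem_apply_self,
    diagElem_apply_pair, zero_mul, zero_smul, Finset.sum_const_zero, add_zero]
  rw [Finset.sum_eq_single z, Pi.single_eq_same, one_smul]
  · simp_rw [← eDiag_eq_diagElem]
    rw [diagElem_eq_sum]
  · intro w _ hw
    rw [Pi.single_eq_of_ne hw, zero_smul]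
  · simp

end Tau

end CommPres

/-! ### The decomposition -/

open CommPres in
theorem mainTheorem1 {K X : Type*} [Field K] [PartialOrder X] [Fintype X] [DecidableEq X]
    [LocallyFiniteOrder X] (hconn : (SimpleGraph.hasse X).Connected) (x₁ : X)
    (φ : IncidenceAlgebra K X →ₗ[K] IncidenceAlgebra K X)
    (hbij : Function.Bijective φ) (hstrong : IsStrongCommPreserver φ)
    (hdiag : PreservesDiagonal φ) :
    ∃ (α : IncidenceAlgebra K X →ₗ[K] diagonal K X) (θ : Equiv.Perm (LtPair X))
      (σ c : LtPair X → Kˣ) (κ : X → K),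
      -- `S_α` is of shift type
      IsShiftType α ∧
      -- `(θ, σ, c, κ)` is a quadruple as required for the definition of `τ`
      IsMonotoneOnMaximalChains θ ∧ IsCompatible θ σ c ∧ IsConstantOnMaximalChains c ∧
      IsAdmissible θ c ∧ ∑ z, κ z ≠ 0 ∧
      -- `τ` is the pure commutativity preserver determined by this quadruple
      IsPure (tau hconn x₁ θ σ c κ) ∧ Induces (tau hconn x₁ θ σ c κ) θ σ ∧
      attachedScalar (tau hconn x₁ θ σ c κ) θ = (fun p => (c p : K)) ∧
      (∀ z, tau hconn x₁ θ σ c κ (eDiag K z) x₁ x₁ = κ z) ∧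
      -- the decomposition
      φ = shiftMap α ∘ₗ tau hconn x₁ θ σ c κ := by
  obtain ⟨θ, σ, c, A, Φ, h⟩ := exists_isMonomial hbij.injective hstrong hdiag
  -- The factor is forced: `α` must send `τ(e_p) = σ(p) e_{θ(p)}` to `A(p)`.
  let B : LtPair X → X → K := fun q => (σ (θ.symm q) : K)⁻¹ • A (θ.symm q)
  let κ : X → K := fun z => Φ (Pi.single z 1) x₁
  have hF : ∀ (z : X) (p : LtPair X),
      Φ (Pi.single z 1) p.1.1 - Φ (Pi.single z 1) p.1.2 = (c (θ.symm p) : K) *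
        ((Pi.single z 1 : X → K) (θ.symm p).1.1 - (Pi.single z 1 : X → K) (θ.symm p).1.2) :=
    fun z p => by rw [← h.diff, Equiv.apply_symm_apply]
  have hB : ∀ p q, p ≠ q → B p q.1.1 - B p q.1.2 = 0 := by
    intro p q hpq
    have := h.diff_eq_zero hstrong (θ.symm.injective.ne hpq)
    rw [Equiv.apply_symm_apply] at this
    simp only [B, Pi.smul_apply, smul_eq_mul, ← mul_sub, this, mul_zero]
  have hτdiag : ∀ z, tau hconn x₁ θ σ c κ (eDiag K z) = diagElem (Φ (Pi.single z 1)) := by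
    intro z
    rw [tau_eDiag]
    congr 1
    ext v
    rw [walkIncrement_eq z (hF z)]
    exact add_sub_cancel _ _
  have hdec : φ = shiftMap (shiftOf B) ∘ₗ tau hconn x₁ θ σ c κ := by
    refine linearMap_ext (fun z => ?_) (fun p => ?_)
    · rw [LinearMap.comp_apply, hτdiag, eDiag_eq_diagElem, h.diag]
      simp [shiftMap, shiftOf_diagElem]
    · rw [LinearMap.comp_apply, tau_eLt, h.pair]
      simp [shiftMap, coe_shiftOf_eLt, B, add_comm]
  have hτinj : Function.Injective (tau hconn x₁ θ σ c κ) := by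
    have := hbij.injective
    rw [hdec, LinearMap.coe_comp] at this
    exact this.of_comp
  have hind : Induces (tau hconn x₁ θ σ c κ) θ σ := tau_eLt hconn x₁ θ σ c κ
  have hsum : ∑ z, κ z ≠ 0 := by
    have hone : ∑ z, κ z = Φ 1 x₁ := by
      rw [← Finset.univ_sum_single (1 : X → K), map_sum, Finset.sum_apply]
      rfl
    -- The sum of `κ` is the value of `Φ 1` at `x₁`. Since `1` has zero differences, `Φ 1` is
    -- constant, and it is nonzero by injectivity of `φ`.
    have hconst : ∀ u v, Φ 1 u = Φ 1 v := eq_of_connected hconn fun p => by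
      have := h.diff (θ.symm p) 1
      rw [Equiv.apply_symm_apply, Pi.one_apply, Pi.one_apply, sub_self, mul_zero] at this
      exact sub_eq_zero.1 this
    intro h0
    have hz : φ (diagElem (1 : X → K)) = φ 0 := by
      rw [h.diag, map_zero, ← map_zero diagElem]
      congr 1
      ext v
      rw [hconst v x₁, ← hone, h0, Pi.zero_apply]
    have := congrArg (fun f : IncidenceAlgebra K X => f x₁ x₁) (hbij.injective hz)
    simp [diagElem_apply_self] at this
  refine ⟨shiftOf B, θ, σ, c, κ, isShiftType_shiftOf hB,
    (h.isMonotoneOnTriples hstrong).isMonotoneOnMaximalChains (h.isMonotoneOnTriples_symm hstrong),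
    h.isCompatible hstrong, h.isConstantOnMaximalChains hstrong, isAdmissible_of_diff hF, hsum,
    ⟨⟨hτinj, LinearMap.injective_iff_surjective.1 hτinj⟩, fun f g => ?_, fun f hf => ?_,
      θ, σ, hind⟩, hind, ?_, fun z => ?_, hdec⟩
  -- `S_α` does not change brackets, so brackets of `φ`-images equal those of `τ`-images.
  · rw [hstrong f g, hdec, LinearMap.comp_apply, LinearMap.comp_apply, shiftMap_lie hB]
  · rw [eq_diagElem_of_mem hf, diagElem_eq_sum, map_sum]
    refine Submodule.sum_mem _ fun z _ => ?_
    rw [map_smul, hτdiag]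
    exact Submodule.smul_mem _ _ (diagElem_mem _)
  · ext p
    rw [attachedScalar, hτdiag, diagElem_apply_self, diagElem_apply_self, h.diff]
    simp [p.2.ne']
  · rw [hτdiag, diagElem_apply_self]
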